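/- Let $F$ be a field of characteristic different from $2$ and $3$, and let $A$ be a finite-dimensional (not necessarily associative or unital) algebra over $F$. Write $(x,y,z)=(xy)z-x(yz)$, and suppose that $A$ is assosymmetric, that is, $(x_1,x_2,x_3)=(x_{\sigma(1)},x_{\sigma(2)},x_{\sigma(3)})$ for all $x_1,x_2,x_3\in A$ and every permutation $\sigma$ of $\{1,2,3\}$. Let $F(A)$ be the intersection of the maximal (proper) subalgebras of $A$ (with $F(A)=A$ if there are none), and let the Frattini ideal $\phi(A)$ be the largest two-sided ideal of $A$ contained in $F(A)$. Then $\phi(A)$ is a nilpotent algebra: putting $B=\phi(A)$, $B^{[1]}=B$ and $B^{[n+1]}=\sum_{i+j=n+1,\ i,j\ge 1}B^{[i]}B^{[j]}$ for $n\geq 1$, where $B^{[i]}B^{[j]}$ denotes the linear span of the products $xy$ with $x\in B^{[i]}$, $y\in B^{[j]}$, one has $B^{[n]}=0$ for some $n\ge 1$. -/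

import Mathlib

namespace Assosymmetric

/-- A (nonassociative) ring or algebra is assosymmetric if its associator `(x,y,z) = (xy)z - x(yz)`
is invariant under every permutation of its three arguments. -/
def IsAssosymmetric (A : Type*) [NonUnitalNonAssocRing A] : Prop :=
  ∀ (σ : Equiv.Perm (Fin 3)) (x : Fin 3 → A),
    associator (x 0) (x 1) (x 2) = associator (x (σ 0)) (x (σ 1)) (x (σ 2))

section

variable (F : Type*) [Field F] (A : Type*) [NonUnitalNonAssocRing A] [Module F A]
  [IsScalarTower F A A] [SMulCommClass F A A]

/-- The powers `A^[n]` of an algebra: `A^[1] = A` and, for `m ≥ 2`, `A^[m]` is the sum of all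
`A^[i] A^[j]` with `i, j ≥ 1` and `i + j = m`, where `BC` is the span of the products `bc`.
The value at `0` is not used. -/
def power : ℕ → Submodule F A
  | 0 => ⊤
  | 1 => ⊤
  | n + 2 => ⨆ i : Fin (n + 1),
      Submodule.map₂ (LinearMap.mul F A) (power (i + 1)) (power (n + 1 - i))

/-- An algebra is nilpotent if `A^[n] = 0` for some `n ≥ 1`. -/
def IsNilpotentAlgebra : Prop := ∃ n : ℕ, 1 ≤ n ∧ power F A n = ⊥

variable {F A} in
/-- A two-sided ideal of the algebra `A`, as a linear subspace. -/
structure IsIdeal (I : Submodule F A) : Prop where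
  mul_mem_left : ∀ a x : A, x ∈ I → a * x ∈ I
  mul_mem_right : ∀ x a : A, x ∈ I → x * a ∈ I

/-- The Frattini subalgebra: the intersection of the maximal (proper) subalgebras. It is `A` itself
if there are none. -/
def frattiniSubalgebra : NonUnitalSubalgebra F A :=
  sInf {M : NonUnitalSubalgebra F A | IsCoatom M}

/-- The sum of all ideals of `A` contained in the Frattini subalgebra. -/
def frattiniSum : Submodule F A :=
  sSup {I : Submodule F A | IsIdeal I ∧ I ≤ (frattiniSubalgebra F A).toSubmodule}

theorem isIdeal_frattiniSum : IsIdeal (frattiniSum F A) := by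
  constructor
  · intro a x hx
    have h : frattiniSum F A ≤ (frattiniSum F A).comap (LinearMap.mulLeft F a) :=
      sSup_le fun I hI y hy => (le_sSup hI : I ≤ frattiniSum F A) (hI.1.mul_mem_left a y hy)
    exact h hx
  · intro x a hx
    have h : frattiniSum F A ≤ (frattiniSum F A).comap (LinearMap.mulRight F a) :=
      sSup_le fun I hI y hy => (le_sSup hI : I ≤ frattiniSum F A) (hI.1.mul_mem_right y a hy)
    exact h hx

/-- The Frattini ideal: the largest ideal of `A` contained in the Frattini subalgebra, regarded as
a subalgebra of `A`. -/
def frattiniIdeal : NonUnitalSubalgebra F A :=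
  { frattiniSum F A with
    mul_mem' := fun {a b} _ hb => (isIdeal_frattiniSum F A).mul_mem_left a b hb }

/-- The Frattini ideal is indeed the largest ideal contained in the Frattini subalgebra. -/
theorem isGreatest_frattiniIdeal :
    IsGreatest {I : Submodule F A | IsIdeal I ∧ I ≤ (frattiniSubalgebra F A).toSubmodule}
      (frattiniIdeal F A).toSubmodule :=
  ⟨⟨isIdeal_frattiniSum F A, sSup_le fun _ hI => hI.2⟩, fun _ hI => le_sSup hI⟩

end

end Assosymmetric

/-! Let `D` be the ideal generated by the associators. Outside characteristic 2 and 3, each map `x ↦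
(x,y,z)` is a derivation that kills commutators and associators, and any two associators multiply to
zero. Hence `A/D` is associative, any product of three elements with a factor in `D` is associative,
and `D * D = 0`.

Let `b ∈ φ(A)`. Modulo `D`, powers of left multiplication `L_b` commute with right multiplications,
so the preimage of `D` under `L_b ^ n` is a subalgebra. For large `n` it contains the Fitting null
component of `L_b`, while the complementary component lies in `φ(A)`. Since elements of `φ(A)` are
non-generators, this subalgebra is `A`: thus `L_b` is nilpotent on `A/D`. On `D` one has `L_b ^
(n+1) d = (L_b ^ n b) d ∈ D * D = 0`. Right multiplications are symmetric.

Engel's theorem, applied to the operators `L_b + R_c` on `A/D` and then on `D`, shows that long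
enough products of multiplications by elements of `φ(A)` vanish, which forces `φ(A)` to be
nilpotent. -/

namespace Assosymmetric

/-! ### Identities of assosymmetric rings -/

section Identities

variable {A : Type*} [NonUnitalNonAssocRing A]

theorem IsAssosymmetric.swap_left (hA : IsAssosymmetric A) (x y z : A) :
    associator x y z = associator y x z :=
  hA (Equiv.swap 0 1) ![x, y, z]

theorem IsAssosymmetric.swap_right (hA : IsAssosymmetric A) (x y z : A) :
    associator x y z = associator x z y :=
  hA (Equiv.swap 1 2) ![x, y, z]

theorem associator_add_left (x x' y z : A) :
    associator (x + x') y z = associator x y z + associator x' y z := by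
  simp only [associator_apply, add_mul]; abel

theorem associator_sub_left (x x' y z : A) :
    associator (x - x') y z = associator x y z - associator x' y z := by
  simp only [associator_apply, sub_mul]; abel

theorem IsAssosymmetric.cocycle (hA : IsAssosymmetric A) (w x y z : A) :
    associator (w * x) y z - associator (x * y) w z + associator (y * z) w x =
      w * associator x y z + associator w x y * z := by
  have h := associator_cocycle w x y z
  rw [hA.swap_left w (x * y) z, hA.swap_right w x (y * z), hA.swap_left w (y * z) x] at h
  grind

/-- Commutators lie in the nucleus. -/
theorem IsAssosymmetric.associator_mul_comm (hA : IsAssosymmetric A)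
    (h2 : ∀ x : A, x + x = 0 → x = 0) (w x y z : A) :
    associator (w * x) y z = associator (x * w) y z := by
  have s1 := hA.swap_left
  have s2 := hA.swap_right
  -- The combination `e1 - e2 - e3 + e4 + e5 - e6` is twice the claim.
  have e1 := hA.cocycle x z y w
  have e2 := hA.cocycle z y x w
  have e3 := hA.cocycle x w z y
  have e4 := hA.cocycle z y w x
  have e5 := hA.cocycle w x z y
  have e6 := hA.cocycle w z y x
  rw [← sub_eq_zero]
  apply h2
  simp only [s1, s2] at *
  grind

/-- The maps `x ↦ (x, y, z)` are derivations. -/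
theorem IsAssosymmetric.associator_mul (hA : IsAssosymmetric A)
    (h2 : ∀ x : A, x + x = 0 → x = 0) (w x y z : A) :
    associator (w * x) y z = w * associator x y z + associator w y z * x := by
  have s1 := hA.swap_left
  have s2 := hA.swap_right
  -- The combination `-e1 + e2 - e3 + e4 + e5 + e6` is twice the claim.
  have e1 := hA.cocycle y w x z
  have e2 := hA.cocycle z w y x
  have e3 := hA.cocycle z w x y
  have e4 := hA.cocycle y w z x
  have e5 := hA.cocycle w z x y
  have e6 := hA.cocycle w y x z
  rw [← sub_eq_zero]
  apply h2
  simp only [s1, s2] at *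
  grind

/-- Associators lie in the nucleus. -/
theorem IsAssosymmetric.associator_associator (hA : IsAssosymmetric A)
    (h2 : ∀ x : A, x + x = 0 → x = 0) (h3 : ∀ x : A, x + x + x = 0 → x = 0) (w x y u v : A) :
    associator (associator w x y) u v = 0 := by
  have s1 := hA.swap_left
  have s2 := hA.swap_right
  -- By symmetry of the associator, `(w,x,y) = [wx,y] - w[x,y] - [w,y]x`. The derivation `(·,u,v)`
  -- is applied to this; it kills commutators.
  have key : ∀ w x y : A, associator (associator w x y) u v =
      -(associator w u v * (x * y - y * x)) - (w * y - y * w) * associator x u v := by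
    intro w x y
    have h : associator w x y - associator w y x + associator y w x =
        ((w * x) * y - y * (w * x)) - w * (x * y - y * x) - (w * y - y * w) * x := by
      simp only [associator_apply, mul_sub, sub_mul]; abel
    rw [s2 w y x, sub_self, zero_add, s1 y w x, s2 w y x] at h
    have c : ∀ a b : A, associator (a * b - b * a) u v = 0 := fun a b => by
      rw [associator_sub_left, hA.associator_mul_comm h2, sub_self]
    rw [h, associator_sub_left, associator_sub_left, c, hA.associator_mul h2,
      hA.associator_mul h2 (w * y - y * w), c, c]
    simp
  -- Summed over all permutations of `w, x, y`, the right sides cancel because commutators are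
  -- antisymmetric, leaving six times the claim.
  have e1 := key w x y
  have e2 := key w y x
  have e3 := key x w y
  have e4 := key x y w
  have e5 := key y w x
  have e6 := key y x w
  rw [s2 w y x] at e2
  rw [s1 x w y] at e3
  rw [s2 x y w, s1 x w y] at e4
  rw [s1 y w x, s2 w y x] at e5
  rw [s2 y x w, s1 y w x, s2 w y x] at e6
  simp only [mul_sub, sub_mul] at e1 e2 e3 e4 e5 e6
  apply h3
  apply h2
  grind

/-- Two derivations `(·,y,z)` and `(·,u,v)` compose to zero on `w`, `x` and `wx`, so exchanging the
pairs `{y,z}` and `{u,v}` in `(w,y,z)(x,u,v)` changes the sign. Three such exchanges return the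
product to itself with sign `-1`. -/
theorem IsAssosymmetric.associator_mul_associator (hA : IsAssosymmetric A)
    (h2 : ∀ x : A, x + x = 0 → x = 0) (h3 : ∀ x : A, x + x + x = 0 → x = 0) (a b c d e f : A) :
    associator a b c * associator d e f = 0 := by
  have key : ∀ w y z x u v : A, associator w y z * associator x u v +
      associator w u v * associator x y z = 0 := by
    intro w y z x u v
    have h := hA.associator_associator h2 h3 (w * x) y z u v
    rw [hA.associator_mul h2, associator_add_left, hA.associator_mul h2, hA.associator_mul h2,
      hA.associator_associator h2 h3, hA.associator_associator h2 h3] at h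
    simpa [add_comm] using h
  have s1 := hA.swap_left
  have s2 := hA.swap_right
  have e1 := key a b c f d e
  have e2 := key d a e c b f
  have e3 := key b d f e a c
  apply h2
  simp only [s1, s2] at *
  grind

end Identities
-- Engel's theorem for two commuting actions
section Engel

attribute [local instance] LieRing.ofAssociativeRing

/-- A form of Engel's theorem. If `l` and `r` are commuting left and right actions of an algebra
on `V` for which the elements of a subalgebra `B` act nilpotently, then the products of the operators
`l b` and `r b` with `b ∈ B` of some fixed length vanish. -/
theorem exists_eq_bot_of_isNilpotent {F A V : Type*} [Field F] [NonUnitalNonAssocRing A]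
    [Module F A] [IsScalarTower F A A] [SMulCommClass F A A] [AddCommGroup V] [Module F V]
    [FiniteDimensional F V] (B : NonUnitalSubalgebra F A) (l r : A →ₗ[F] Module.End F V)
    (hl : ∀ x y, l (x * y) = l x * l y) (hr : ∀ x y, r (x * y) = r y * r x)
    (hlr : ∀ x y, Commute (l x) (r y))
    (nl : ∀ b ∈ B, IsNilpotent (l b)) (nr : ∀ b ∈ B, IsNilpotent (r b)) :
    ∃ n : ℕ, ∀ W : ℕ → Submodule F V,
      (∀ k (U : Submodule F V), (∀ b ∈ B, ∀ v ∈ W k, l b v ∈ U ∧ r b v ∈ U) → W (k + 1) ≤ U) →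
      W n = ⊥ := by
  -- The operators `l b + r c` are closed under brackets, since `[l b + r c, l b' + r c'] = l [b,b']
  -- + r [c',c]`. Each is a sum of two commuting nilpotents, so Engel's theorem applies.
  let X : LieSubalgebra F (Module.End F V) :=
    { B.toSubmodule.map l ⊔ B.toSubmodule.map r with
      lie_mem' := by
        intro S T hS hT
        simp only [AddSubsemigroup.mem_carrier, AddSubmonoid.mem_toSubsemigroup,
          Submodule.mem_toAddSubmonoid, Submodule.mem_sup, Submodule.mem_map] at hS hT ⊢
        obtain ⟨_, ⟨b, hb, rfl⟩, _, ⟨c, hc, rfl⟩, rfl⟩ := hS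
        obtain ⟨_, ⟨b', hb', rfl⟩, _, ⟨c', hc', rfl⟩, rfl⟩ := hT
        refine ⟨_, ⟨b * b' - b' * b, B.sub_mem (B.mul_mem hb hb') (B.mul_mem hb' hb), rfl⟩,
          _, ⟨c' * c - c * c', B.sub_mem (B.mul_mem hc' hc) (B.mul_mem hc hc'), rfl⟩, ?_⟩
        have h1 := (hlr b c').eq
        have h2 := (hlr b' c).eq
        simp only [map_sub, hl, hr, Ring.lie_def, mul_add, add_mul, h1, h2]
        abel }
  have hX : ∀ T, T ∈ X ↔ T ∈ B.toSubmodule.map l ⊔ B.toSubmodule.map r := fun T => Iff.rfl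
  have hlX : ∀ b ∈ B, l b ∈ X := fun b hb =>
    (hX _).2 (Submodule.mem_sup_left (Submodule.mem_map_of_mem hb))
  have hrX : ∀ b ∈ B, r b ∈ X := fun b hb =>
    (hX _).2 (Submodule.mem_sup_right (Submodule.mem_map_of_mem hb))
  have hnil : LieModule.IsNilpotent X V := by
    rw [LieModule.isNilpotent_iff_forall' (R := F)]
    rintro ⟨T, hT⟩
    change IsNilpotent T
    obtain ⟨_, ⟨b, hb, rfl⟩, _, ⟨c, hc, rfl⟩, rfl⟩ := Submodule.mem_sup.1 ((hX T).1 hT)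
    exact (hlr b c).isNilpotent_add (nl b hb) (nr c hc)
  obtain ⟨n, hn⟩ := (LieModule.isNilpotent_iff F X V).1 hnil
  refine ⟨n, fun W hW => ?_⟩
  have main : ∀ k, W k ≤ (LieModule.lowerCentralSeries F X V k).toSubmodule := by
    intro k
    induction k with
    | zero => simp
    | succ k ih =>
      refine hW k _ fun b hb v hv => ?_
      rw [LieModule.lowerCentralSeries_succ]
      exact ⟨LieSubmodule.lie_mem_lie (LieSubmodule.mem_top (⟨l b, hlX b hb⟩ : X)) (ih hv),
        LieSubmodule.lie_mem_lie (LieSubmodule.mem_top (⟨r b, hrX b hb⟩ : X)) (ih hv)⟩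
  have := main n
  rw [hn] at this
  simpa using this

end Engel

/-! ### Non-generators and the Fitting decomposition -/

section

variable {F A : Type*} [Field F] [NonUnitalNonAssocRing A] [Module F A]
  [IsScalarTower F A A] [SMulCommClass F A A]

/-- Elements of the Frattini subalgebra are non-generators. -/
theorem eq_top_of_le_frattini_sup [FiniteDimensional F A] {I : Submodule F A}
    (hI : I ≤ (frattiniSubalgebra F A).toSubmodule) (C : NonUnitalSubalgebra F A)
    (hC : I ⊔ C.toSubmodule = ⊤) : C = ⊤ := by
  have : StrictMono (NonUnitalSubalgebra.toSubmodule : NonUnitalSubalgebra F A → Submodule F A) :=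
    fun S T h => h
  have := this.wellFoundedGT
  rcases eq_top_or_exists_le_coatom C with h | ⟨M, hM, hCM⟩
  · exact h
  · refine (hM.1 (top_unique fun x _ => ?_)).elim
    have hx : x ∈ I ⊔ C.toSubmodule := hC ▸ Submodule.mem_top
    have hIM : I ≤ M.toSubmodule := hI.trans fun y hy => (sInf_le hM : frattiniSubalgebra F A ≤ M) hy
    exact (sup_le hIM (fun y hy => hCM hy : C.toSubmodule ≤ M.toSubmodule)) hx

/-- Let `T` be an endomorphism of `A` with range in an ideal contained in the Frattini subalgebra,
and suppose that the preimages of `D` under the powers of `T` are subalgebras. Then some power of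
`T` has range in `D`. -/
theorem exists_pow_mem_of_range_le [FiniteDimensional F A] {I D : Submodule F A}
    (hI : I ≤ (frattiniSubalgebra F A).toSubmodule) (T : Module.End F A) (hT : ∀ x, T x ∈ I)
    (hD : ∀ n x y, (T ^ n) x ∈ D → (T ^ n) y ∈ D → (T ^ n) (x * y) ∈ D) :
    ∃ n, ∀ x, (T ^ n) x ∈ D := by
  obtain ⟨N, hN⟩ := Filter.eventually_atTop.1 T.eventually_isCompl_ker_pow_range_pow
  -- The exponent must be positive for the range of the power to lie in the range of `T`, hence in
  -- `I`; `N` itself may be `0`.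
  have hc := hN (N + 1) N.le_succ
  let C : NonUnitalSubalgebra F A :=
    { D.comap (T ^ (N + 1)) with mul_mem' := fun {x y} hx hy => hD (N + 1) x y hx hy }
  have hC : C = ⊤ := by
    refine eq_top_of_le_frattini_sup hI C (top_unique ?_)
    rw [← hc.sup_eq_top, sup_comm]
    refine sup_le_sup ?_ fun x hx => ?_
    · rintro _ ⟨y, rfl⟩
      rw [pow_succ']
      exact hT _
    · change (T ^ (N + 1)) x ∈ D
      rw [LinearMap.mem_ker.1 hx]
      exact D.zero_mem
  refine ⟨N + 1, fun x => ?_⟩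
  have : x ∈ C := hC ▸ NonUnitalAlgebra.mem_top
  exact this

end

/-! ### The associator ideal and its square -/

section

variable {F A : Type*} [Field F] [NonUnitalNonAssocRing A] [Module F A]

variable (F A) in
/-- The ideal generated by the associators. -/
def associatorIdeal : Submodule F A :=
  Submodule.span F ({s | ∃ x y z : A, s = associator x y z} ∪
    {s | ∃ x y z a : A, s = associator x y z * a})

theorem associator_mem (x y z : A) : associator x y z ∈ associatorIdeal F A :=
  Submodule.subset_span (Or.inl ⟨x, y, z, rfl⟩)

theorem associator_mul_mem (x y z a : A) : associator x y z * a ∈ associatorIdeal F A :=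
  Submodule.subset_span (Or.inr ⟨x, y, z, a, rfl⟩)

theorem associatorIdeal_le {U : Submodule F A} (h1 : ∀ x y z : A, associator x y z ∈ U)
    (h2 : ∀ x y z a : A, associator x y z * a ∈ U) : associatorIdeal F A ≤ U := by
  refine Submodule.span_le.2 (Set.union_subset ?_ ?_)
  · rintro _ ⟨x, y, z, rfl⟩
    exact h1 x y z
  · rintro _ ⟨x, y, z, a, rfl⟩
    exact h2 x y z a

end

section

variable {F A : Type*} [Field F] [NonUnitalNonAssocRing A] [Module F A]
  [IsScalarTower F A A]

theorem IsAssosymmetric.associator_of_mem_associatorIdeal (hA : IsAssosymmetric A)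
    (h2 : ∀ x : A, x + x = 0 → x = 0) (h3 : ∀ x : A, x + x + x = 0 → x = 0) {d : A} (hd : d ∈ associatorIdeal F A) (x y : A) :
    associator d x y = 0 := by
  let U : Submodule F A := LinearMap.ker
    ((LinearMap.mulRight F y) ∘ₗ (LinearMap.mulRight F x) - LinearMap.mulRight F (x * y))
  have hU : ∀ d, d ∈ U ↔ associator d x y = 0 := fun d => by
    simp [U, associator_apply]
  refine (hU d).1 (associatorIdeal_le (fun a b c => ?_) (fun a b c e => ?_) hd)
  · rw [hU]
    exact hA.associator_associator h2 h3 a b c x y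
  · rw [hU, hA.associator_mul h2, hA.associator_associator h2 h3,
      hA.associator_mul_associator h2 h3]
    simp

theorem IsAssosymmetric.mul_assoc_left (hA : IsAssosymmetric A)
    (h2 : ∀ x : A, x + x = 0 → x = 0) (h3 : ∀ x : A, x + x + x = 0 → x = 0) {d : A}
    (hd : d ∈ associatorIdeal F A) (x y : A) : (d * x) * y = d * (x * y) :=
  sub_eq_zero.1 (hA.associator_of_mem_associatorIdeal h2 h3 hd x y)

theorem IsAssosymmetric.mul_assoc_middle (hA : IsAssosymmetric A)
    (h2 : ∀ x : A, x + x = 0 → x = 0) (h3 : ∀ x : A, x + x + x = 0 → x = 0) {d : A}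
    (hd : d ∈ associatorIdeal F A) (x y : A) : (x * d) * y = x * (d * y) :=
  sub_eq_zero.1 ((hA.swap_left x d y).trans (hA.associator_of_mem_associatorIdeal h2 h3 hd x y))

theorem IsAssosymmetric.mul_assoc_right (hA : IsAssosymmetric A)
    (h2 : ∀ x : A, x + x = 0 → x = 0) (h3 : ∀ x : A, x + x + x = 0 → x = 0) {d : A}
    (hd : d ∈ associatorIdeal F A) (x y : A) : (x * y) * d = x * (y * d) :=
  sub_eq_zero.1 (((hA.swap_right x y d).trans (hA.swap_left x d y)).trans
    (hA.associator_of_mem_associatorIdeal h2 h3 hd x y))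

variable [SMulCommClass F A A]

theorem IsAssosymmetric.isIdeal_associatorIdeal (hA : IsAssosymmetric A)
    (h2 : ∀ x : A, x + x = 0 → x = 0) (h3 : ∀ x : A, x + x + x = 0 → x = 0) :
    IsIdeal (associatorIdeal F A) := by
  -- The derivation rule rewrites left multiples through associators and right multiples, so the
  -- one-sided spanning set suffices.
  have left : ∀ a x y z : A, a * associator x y z =
      associator (a * x) y z - associator a y z * x := fun a x y z => by
    rw [hA.associator_mul h2, add_sub_cancel_right]
  constructor
  · intro a x hx
    refine (associatorIdeal_le (U := (associatorIdeal F A).comap (LinearMap.mulLeft F a))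
      (fun x y z => ?_) (fun x y z c => ?_)) hx
    · change a * associator x y z ∈ associatorIdeal F A
      rw [left]
      exact sub_mem (associator_mem _ _ _) (associator_mul_mem _ _ _ _)
    · change a * (associator x y z * c) ∈ associatorIdeal F A
      rw [← hA.mul_assoc_middle h2 h3 (associator_mem (F := F) x y z), left, sub_mul,
        hA.mul_assoc_left h2 h3 (associator_mem (F := F) a y z)]
      exact sub_mem (associator_mul_mem _ _ _ _) (associator_mul_mem _ _ _ _)
  · intro x a hx
    refine (associatorIdeal_le (U := (associatorIdeal F A).comap (LinearMap.mulRight F a))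
      (fun x y z => ?_) (fun x y z c => ?_)) hx
    · exact associator_mul_mem _ _ _ _
    · change (associator x y z * c) * a ∈ associatorIdeal F A
      rw [hA.mul_assoc_left h2 h3 (associator_mem (F := F) x y z)]
      exact associator_mul_mem _ _ _ _

theorem IsAssosymmetric.mul_eq_zero_of_mem_associatorIdeal (hA : IsAssosymmetric A)
    (h2 : ∀ x : A, x + x = 0 → x = 0) (h3 : ∀ x : A, x + x + x = 0 → x = 0) {d e : A}
    (hd : d ∈ associatorIdeal F A) (he : e ∈ associatorIdeal F A) : d * e = 0 := by
  have hs : ∀ x y z e : A, e ∈ associatorIdeal F A → associator x y z * e = 0 := by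
    intro x y z e he
    refine (associatorIdeal_le (U := LinearMap.ker (LinearMap.mulLeft F (associator x y z)))
      (fun a b c => ?_) (fun a b c e => ?_)) he
    · exact hA.associator_mul_associator h2 h3 _ _ _ _ _ _
    · change associator x y z * (associator a b c * e) = 0
      rw [← hA.mul_assoc_left h2 h3 (associator_mem (F := F) x y z),
        hA.associator_mul_associator h2 h3, zero_mul]
  refine (associatorIdeal_le (U := LinearMap.ker (LinearMap.mulRight F e))
      (fun a b c => ?_) (fun a b c x => ?_)) hd
  · exact hs _ _ _ _ he
  · change (associator a b c * x) * e = 0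
    rw [hA.mul_assoc_left h2 h3 (associator_mem (F := F) a b c)]
    exact hs _ _ _ _ ((hA.isIdeal_associatorIdeal h2 h3).mul_mem_left _ _ he)

end

/-! ### Induced actions on quotients and subspaces -/

section

variable {F A V : Type*} [Field F] [AddCommGroup A] [Module F A] [AddCommGroup V] [Module F V]
  {D : Submodule F V}

/-- The representation induced on the quotient by an invariant subspace. -/
def quotientRep (φ : A →ₗ[F] Module.End F V) (h : ∀ x, D ≤ D.comap (φ x)) :
    A →ₗ[F] Module.End F (V ⧸ D) where
  toFun x := D.mapQ D (φ x) (h x)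
  map_add' x y := by ext v; simp
  map_smul' c x := by ext v; simp

theorem isNilpotent_quotientRep (φ : A →ₗ[F] Module.End F V) (h : ∀ x, D ≤ D.comap (φ x)) {x : A}
    {n : ℕ} (hn : ∀ v, (φ x ^ n) v ∈ D) : IsNilpotent (quotientRep φ h x) := by
  refine ⟨n, ?_⟩
  change D.mapQ D (φ x) (h x) ^ n = 0
  rw [← Submodule.mapQ_pow]
  ext v
  simpa using hn v

/-- The representation induced on an invariant subspace. -/
def subRep (φ : A →ₗ[F] Module.End F V) (h : ∀ x, D ≤ D.comap (φ x)) :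
    A →ₗ[F] Module.End F D where
  toFun x := (φ x).restrict (h x)
  map_add' x y := by ext v; simp
  map_smul' c x := by ext v; simp

theorem isNilpotent_subRep (φ : A →ₗ[F] Module.End F V) (h : ∀ x, D ≤ D.comap (φ x)) {x : A}
    {n : ℕ} (hn : ∀ v ∈ D, (φ x ^ n) v = 0) : IsNilpotent (subRep φ h x) := by
  refine ⟨n, ?_⟩
  change (φ x).restrict (h x) ^ n = 0
  rw [Module.End.pow_restrict]
  ext v
  simpa using hn v v.2

end

/-! ### Powers of multiplication operators -/

section

variable {F A : Type*} [Field F] [NonUnitalNonAssocRing A] [Module F A] [SMulCommClass F A A]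

/-- Modulo `D` multiplication is associative, so left multiplications commute with right ones. This
makes the preimage of `D` under a power of left multiplication closed under products. -/
theorem mulLeft_pow_mul_mem {D : Submodule F A} (hD : IsIdeal D)
    (hassoc : ∀ x y z : A, associator x y z ∈ D) (b : A) (n : ℕ) (x y : A) :
    (LinearMap.mulLeft F b ^ n) (x * y) - (LinearMap.mulLeft F b ^ n) x * y ∈ D := by
  induction n with
  | zero => simp
  | succ n ih =>
    rw [pow_succ']
    have h1 := hD.mul_mem_left b _ ih
    have h2 := hassoc b ((LinearMap.mulLeft F b ^ n) x) y
    rw [mul_sub] at h1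
    rw [associator_apply] at h2
    have := sub_mem h1 h2
    simpa using this

/-- This transfers nilpotency from `A/D` to `D`: once the power of `b` on the right side lies in
`D`, the product lies in `D * D`. -/
theorem mulLeft_pow_mul {d b : A} (hd : ∀ x y : A, (x * y) * d = x * (y * d)) (n : ℕ) :
    (LinearMap.mulLeft F b ^ (n + 1)) d = (LinearMap.mulLeft F b ^ n) b * d := by
  induction n with
  | zero => simp
  | succ n ih =>
    rw [pow_succ', Module.End.mul_apply, ih, pow_succ', Module.End.mul_apply,
      LinearMap.mulLeft_apply, LinearMap.mulLeft_apply, hd]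

end

section

variable {F A : Type*} [Field F] [NonUnitalNonAssocRing A] [Module F A] [IsScalarTower F A A]

theorem mulRight_pow_mul_mem {D : Submodule F A} (hD : IsIdeal D)
    (hassoc : ∀ x y z : A, associator x y z ∈ D) (b : A) (n : ℕ) (x y : A) :
    (LinearMap.mulRight F b ^ n) (x * y) - x * (LinearMap.mulRight F b ^ n) y ∈ D := by
  induction n with
  | zero => simp
  | succ n ih =>
    rw [pow_succ']
    have h1 := hD.mul_mem_right _ b ih
    have h2 := hassoc x ((LinearMap.mulRight F b ^ n) y) b
    rw [sub_mul] at h1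
    rw [associator_apply] at h2
    have := add_mem h1 h2
    simpa using this

theorem mulRight_pow_mul {d b : A} (hd : ∀ x y : A, (d * x) * y = d * (x * y)) (n : ℕ) :
    (LinearMap.mulRight F b ^ (n + 1)) d = d * (LinearMap.mulRight F b ^ n) b := by
  induction n with
  | zero => simp
  | succ n ih =>
    rw [pow_succ', Module.End.mul_apply, ih, pow_succ', Module.End.mul_apply,
      LinearMap.mulRight_apply, LinearMap.mulRight_apply, hd]

end

/-! ### From nilpotent multiplications to a nilpotent algebra -/

section

variable {F A : Type*} [Field F] [NonUnitalNonAssocRing A] [Module F A]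
  [IsScalarTower F A A] [SMulCommClass F A A]

/-- Left multiplications by elements of an ideal in the Frattini subalgebra are nilpotent modulo any
ideal containing the associators. -/
theorem exists_mulLeft_pow_mem [FiniteDimensional F A] {I D : Submodule F A}
    (hI : I ≤ (frattiniSubalgebra F A).toSubmodule) (hI' : IsIdeal I) (hD : IsIdeal D)
    (hassoc : ∀ x y z : A, associator x y z ∈ D) {b : A} (hb : b ∈ I) :
    ∃ n, ∀ x, (LinearMap.mulLeft F b ^ n) x ∈ D := by
  refine exists_pow_mem_of_range_le hI _ (fun x => hI'.mul_mem_right b x hb) fun n x y hx _ => ?_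
  have := add_mem (mulLeft_pow_mul_mem hD hassoc b n x y) (hD.mul_mem_right _ y hx)
  simpa using this

theorem exists_mulRight_pow_mem [FiniteDimensional F A] {I D : Submodule F A}
    (hI : I ≤ (frattiniSubalgebra F A).toSubmodule) (hI' : IsIdeal I) (hD : IsIdeal D)
    (hassoc : ∀ x y z : A, associator x y z ∈ D) {b : A} (hb : b ∈ I) :
    ∃ n, ∀ x, (LinearMap.mulRight F b ^ n) x ∈ D := by
  refine exists_pow_mem_of_range_le hI _ (fun x => hI'.mul_mem_left x b hb) fun n x y _ hy => ?_
  have := add_mem (mulRight_pow_mul_mem hD hassoc b n x y) (hD.mul_mem_left x _ hy)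
  simpa using this

/-- The spans of the products of `k` multiplications by elements of `B` applied to `A`. -/
def multSeries (B : Submodule F A) : ℕ → Submodule F A
  | 0 => ⊤
  | k + 1 => Submodule.map₂ (LinearMap.mul F A) B (multSeries B k) ⊔
      Submodule.map₂ (LinearMap.mul F A) (multSeries B k) B

theorem multSeries_succ_le {B U : Submodule F A} {k : ℕ}
    (h : ∀ b ∈ B, ∀ v ∈ multSeries B k, b * v ∈ U ∧ v * b ∈ U) : multSeries B (k + 1) ≤ U :=
  sup_le (Submodule.map₂_le.2 fun b hb v hv => (h b hb v hv).1)
    (Submodule.map₂_le.2 fun v hv b hb => (h b hb v hv).2)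

theorem multSeries_antitone (B : Submodule F A) : Antitone (multSeries B) := by
  refine antitone_nat_of_succ_le fun k => ?_
  induction k with
  | zero => exact le_top
  | succ k ih => exact sup_le_sup (Submodule.map₂_le_map₂_right ih) (Submodule.map₂_le_map₂_left ih)

theorem map_power_le_multSeries (B : NonUnitalSubalgebra F A) (k m : ℕ) (hm : 2 ^ k ≤ m) :
    (power F B m).map B.toSubmodule.subtype ≤ multSeries B.toSubmodule k := by
  induction k generalizing m with
  | zero => exact le_top
  | succ k ih =>
    match m, hm with
    | 0, hm => simp at hm
    | 1, hm => simp [pow_succ] at hm; have := Nat.one_le_two_pow (n := k); omega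
    | m + 2, hm =>
      rw [Submodule.map_le_iff_le_comap, power]
      refine iSup_le fun i => Submodule.map₂_le.2 fun x hx y hy => ?_
      change (x : A) * (y : A) ∈ multSeries B.toSubmodule (k + 1)
      -- The two indices add up to `m + 2 ≥ 2 ^ (k + 1)`, so one of them is at least `2 ^ k`; the
      -- other factor is only used as an element of `B`.
      rcases le_total (2 ^ k) (m + 1 - (i : ℕ)) with h | h
      · exact Submodule.mem_sup_left (Submodule.apply_mem_map₂ _ x.2
          (ih _ h (Submodule.mem_map_of_mem hy)))
      · have h' : 2 ^ k ≤ (i : ℕ) + 1 := by rw [pow_succ] at hm; omega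
        exact Submodule.mem_sup_right (Submodule.apply_mem_map₂ _
          (ih _ h' (Submodule.mem_map_of_mem hx)) y.2)

theorem isNilpotentAlgebra_of_multSeries_eq_bot {B : NonUnitalSubalgebra F A} {k : ℕ}
    (h : multSeries B.toSubmodule k = ⊥) : IsNilpotentAlgebra F B := by
  refine ⟨2 ^ k, Nat.one_le_two_pow, ?_⟩
  have := map_power_le_multSeries B k _ le_rfl
  rw [h] at this
  exact (Submodule.eq_bot_iff _).2 fun x hx =>
    Subtype.ext ((Submodule.mem_bot F).1 (this (Submodule.mem_map_of_mem hx)))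

/-- If the elements of `B` act nilpotently on an algebra `A` modulo an ideal `D`, and on `D`, and
the actions are associative, then `B` is nilpotent. -/
theorem isNilpotentAlgebra_of_isNilpotent [FiniteDimensional F A] (B : NonUnitalSubalgebra F A)
    {D : Submodule F A} (hD : IsIdeal D) (hassoc : ∀ x y z : A, associator x y z ∈ D)
    (hl : ∀ d ∈ D, ∀ x y : A, (d * x) * y = d * (x * y))
    (hm : ∀ d ∈ D, ∀ x y : A, (x * d) * y = x * (d * y))
    (hr : ∀ d ∈ D, ∀ x y : A, (x * y) * d = x * (y * d))
    (hB : ∀ b ∈ B, ∃ n, ∀ x, (LinearMap.mulLeft F b ^ n) x ∈ D)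
    (hB' : ∀ b ∈ B, ∃ n, ∀ x, (LinearMap.mulRight F b ^ n) x ∈ D)
    (hBD : ∀ b ∈ B, ∃ n, ∀ x ∈ D, (LinearMap.mulLeft F b ^ n) x = 0)
    (hBD' : ∀ b ∈ B, ∃ n, ∀ x ∈ D, (LinearMap.mulRight F b ^ n) x = 0) :
    IsNilpotentAlgebra F B := by
  have iL : ∀ x, D ≤ D.comap (LinearMap.mul F A x) := fun x d hd => hD.mul_mem_left x d hd
  have iR : ∀ x, D ≤ D.comap ((LinearMap.mul F A).flip x) := fun x d hd => hD.mul_mem_right d x hd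
  obtain ⟨n, hn⟩ := exists_eq_bot_of_isNilpotent B (quotientRep _ iL) (quotientRep _ iR)
    (fun x y => by
      ext v
      exact (Submodule.Quotient.eq D).2 (hassoc x y v))
    (fun x y => by
      ext v
      exact (Submodule.Quotient.eq' D).2 (by simpa [associator_apply, sub_eq_neg_add] using hassoc v x y))
    (fun x y => by
      ext v
      exact (Submodule.Quotient.eq' D).2 (by simpa [associator_apply, sub_eq_neg_add] using hassoc x v y))
    (fun b hb => (hB b hb).elim fun n h => isNilpotent_quotientRep _ _ h)
    (fun b hb => (hB' b hb).elim fun n h => isNilpotent_quotientRep _ _ h)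
  obtain ⟨m, hm⟩ := exists_eq_bot_of_isNilpotent B (subRep _ iL) (subRep _ iR)
    (fun x y => by
      ext v
      exact hr v v.2 x y)
    (fun x y => by
      ext v
      exact (hl v v.2 x y).symm)
    (fun x y => by
      ext v
      exact (hm v v.2 x y).symm)
    (fun b hb => (hBD b hb).elim fun n h => isNilpotent_subRep _ _ h)
    (fun b hb => (hBD' b hb).elim fun n h => isNilpotent_subRep _ _ h)
  -- Engel on `A/D` pushes the series into `D` after `n` steps; from there Engel on `D` kills the
  -- shifted series after `m` more.
  have h1 : multSeries B.toSubmodule n ≤ D := by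
    have := hn (fun k => (multSeries B.toSubmodule k).map D.mkQ) fun k U hU => by
      rw [Submodule.map_le_iff_le_comap]
      exact multSeries_succ_le fun b hb v hv => hU b hb _ (Submodule.mem_map_of_mem hv)
    exact (LinearMap.le_ker_iff_map.2 this).trans (Submodule.ker_mkQ D).le
  have h2 : ∀ k, multSeries B.toSubmodule (n + k) ≤ D := fun k =>
    (multSeries_antitone _ (Nat.le_add_right n k)).trans h1
  refine isNilpotentAlgebra_of_multSeries_eq_bot (k := n + m) ?_
  have := hm (fun k => (multSeries B.toSubmodule (n + k)).comap D.subtype) fun k U hU => by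
    have : multSeries B.toSubmodule (n + (k + 1)) ≤ U.map D.subtype :=
      multSeries_succ_le fun b hb v hv =>
        ⟨⟨_, (hU b hb ⟨v, h2 k hv⟩ hv).1, rfl⟩, ⟨_, (hU b hb ⟨v, h2 k hv⟩ hv).2, rfl⟩⟩
    refine (Submodule.comap_mono this).trans ?_
    rw [Submodule.comap_map_eq_of_injective D.injective_subtype]
  refine (Submodule.eq_bot_iff _).2 fun x hx => ?_
  have hx' : (⟨x, h2 m hx⟩ : D) ∈ (multSeries B.toSubmodule (n + m)).comap D.subtype := hx
  rw [this, Submodule.mem_bot] at hx'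
  exact congrArg Subtype.val hx'

end

end Assosymmetric

theorem proposition4p5 (F : Type*) [Field F] (hF2 : ringChar F ≠ 2) (hF3 : ringChar F ≠ 3)
    (A : Type*) [NonUnitalNonAssocRing A] [Module F A] [IsScalarTower F A A] [SMulCommClass F A A]
    [FiniteDimensional F A] (hA : Assosymmetric.IsAssosymmetric A) :
    Assosymmetric.IsNilpotentAlgebra F (Assosymmetric.frattiniIdeal F A) := by
  have two : (2 : F) ≠ 0 := Ring.two_ne_zero hF2
  have three : (3 : F) ≠ 0 := by
    intro h
    have h3 : ringChar F ∣ 3 := (ringChar.spec F 3).1 (by exact_mod_cast h)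
    rcases (Nat.dvd_prime Nat.prime_three).1 h3 with h1 | h1
    · exact CharP.ringChar_ne_one h1
    · exact hF3 h1
  have h2 : ∀ x : A, x + x = 0 → x = 0 := fun x hx => by
    rw [← two_smul F] at hx
    exact (smul_eq_zero.1 hx).resolve_left two
  have h3 : ∀ x : A, x + x + x = 0 → x = 0 := fun x hx => by
    have : (3 : F) • x = 0 := by
      rw [← hx, show (3 : F) = 1 + 1 + 1 by norm_num, add_smul, add_smul, one_smul]
    exact (smul_eq_zero.1 this).resolve_left three
  have hD := hA.isIdeal_associatorIdeal (F := F) h2 h3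
  have hI := Assosymmetric.isGreatest_frattiniIdeal F A
  have hL : ∀ b ∈ Assosymmetric.frattiniIdeal F A, _ := fun b hb =>
    Assosymmetric.exists_mulLeft_pow_mem hI.1.2 hI.1.1 hD Assosymmetric.associator_mem hb
  have hR : ∀ b ∈ Assosymmetric.frattiniIdeal F A, _ := fun b hb =>
    Assosymmetric.exists_mulRight_pow_mem hI.1.2 hI.1.1 hD Assosymmetric.associator_mem hb
  refine Assosymmetric.isNilpotentAlgebra_of_isNilpotent _ hD Assosymmetric.associator_mem
    (fun d hd => hA.mul_assoc_left h2 h3 hd) (fun d hd => hA.mul_assoc_middle h2 h3 hd)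
    (fun d hd => hA.mul_assoc_right h2 h3 hd) hL hR (fun b hb => ?_) (fun b hb => ?_)
  · obtain ⟨n, hn⟩ := hL b hb
    -- The extra factor turns the operator power on `d` into `(L_b ^ n b) d`, with `L_b ^ n b ∈ D`
    -- by the choice of `n`.
    refine ⟨n + 1, fun d hd => ?_⟩
    rw [Assosymmetric.mulLeft_pow_mul (hA.mul_assoc_right h2 h3 hd)]
    exact hA.mul_eq_zero_of_mem_associatorIdeal h2 h3 (hn b) hd
  · obtain ⟨n, hn⟩ := hR b hb
    refine ⟨n + 1, fun d hd => ?_⟩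
    rw [Assosymmetric.mulRight_pow_mul (hA.mul_assoc_left h2 h3 hd)]
    exact hA.mul_eq_zero_of_mem_associatorIdeal h2 h3 hd (hn b)
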